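/- Let $\mathbb{H}(\mathbb{C})$ be the algebra of quaternions over $\mathbb{C}$, with basis $1,I,J,K$ ($I^2=J^2=K^2=-1$, $IJ=-JI=K$, $JK=-KJ=I$, $KI=-IK=J$), and let $$e_1=\tfrac12(1+iI),\quad e_2=\tfrac12(1-iI),\quad e_3=\tfrac12(iJ-K),\quad e_4=\tfrac12(iJ+K),$$ where $i$ is the imaginary unit of $\mathbb{C}$. These form a second basis; put $\big\|\sum_k a_ke_k\big\|=\big(\sum_k|a_k|^2\big)^{1/2}$. Let $f_1,f_2:\mathbb{H}(\mathbb{C})\to\mathbb{C}$ be the $\mathbb{C}$-linear functionals with $f_1(e_1)=f_1(e_3)=1$, $f_1(e_2)=f_1(e_4)=0$ and $f_2(e_2)=f_2(e_4)=1$, $f_2(e_1)=f_2(e_3)=0$. Let $a_1,a_2,b_1,b_2\in\mathbb{C}$ be such that $i_1=1$, $i_2=a_1e_1+a_2e_2$, $i_3=b_1e_1+b_2e_2$ are linearly independent over $\mathbb{R}$, let $E_3=\{xi_1+yi_2+zi_3:x,y,z\in\mathbb{R}\}$, and assume $f_1(E_3)=f_2(E_3)=\mathbb{C}$. For $k=1,2$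 let $L_k\subset\mathbb{R}^3$ be the line $x+y\,\mathrm{Re}\,a_k+z\,\mathrm{Re}\,b_k=0$, $y\,\mathrm{Im}\,a_k+z\,\mathrm{Im}\,b_k=0$. Let $\Omega\subset\mathbb{R}^3$ be a domain (nonempty, open and connected) that is convex in the direction of $L_1$ and of $L_2$, i.e. it contains every segment that is parallel to $L_1$ or to $L_2$ and joins two points of $\Omega$. Put $$\Omega_\zeta=\{xi_1+yi_2+zi_3:(x,y,z)\in\Omega\},\quad D_1=f_1(\Omega_\zeta),\quad D_2=f_2(\Omega_\zeta),$$ $$\Pi_\zeta=\{\zeta\in E_3:\ f_1(\zeta)\in D_1,\ f_2(\zeta)\in D_2\}.$$ For a relatively open set $U\subset E_3$, a continuous map $\Phi:U\to\mathbb{H}(\mathbb{C})$ is called right-$G$-monogenic (resp. left-$G$-monogenic) in $U$ if for every $\zeta\in U$ there is $\Phi'(\zeta)\in\mathbb{H}(\mathbb{C})$ such that for all $h\in E_3$ $$\lim_{\varepsilon\to0+}\big(\Phi(\zeta+\varepsilon h)-\Phi(\zeta)\big)\varepsilon^{-1}=h\,\Phi'(\zeta)\qquad\big(\text{resp. }=\Phi'(\zeta)\,h\big).$$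 **Theorem.** Every right-$G$-monogenic map $\Phi:\Omega_\zeta\to\mathbb{H}(\mathbb{C})$ extends to a right-$G$-monogenic map $\Pi_\zeta\to\mathbb{H}(\mathbb{C})$, and every left-$G$-monogenic map $\widehat\Phi:\Omega_\zeta\to\mathbb{H}(\mathbb{C})$ extends to a left-$G$-monogenic map $\Pi_\zeta\to\mathbb{H}(\mathbb{C})$. -/

import Mathlib

open Set Filter Topology
open scoped Quaternion

namespace ComplexQuaternion

/-! The algebra of complex quaternions is Mathlib's `ℍ[ℂ]`, with basis `1, I, J, K` over `ℂ`. -/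

/-- The second basis `e₁, e₂, e₃, e₄` of `ℍ[ℂ]` (indexed from `0`), where `i` is the imaginary unit
of `ℂ`: `(1 + iI)/2`, `(1 - iI)/2`, `(iJ - K)/2`, `(iJ + K)/2`. -/
noncomputable def e : Fin 4 → ℍ[ℂ] :=
  ![⟨1 / 2, Complex.I / 2, 0, 0⟩,
    ⟨1 / 2, -Complex.I / 2, 0, 0⟩,
    ⟨0, 0, Complex.I / 2, -1 / 2⟩,
    ⟨0, 0, Complex.I / 2, 1 / 2⟩]

theorem e_re (k : Fin 4) : (e k).re = (![1 / 2, 1 / 2, 0, 0] : Fin 4 → ℂ) k := by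
  fin_cases k <;> rfl

theorem e_imI (k : Fin 4) :
    (e k).imI = (![Complex.I / 2, -Complex.I / 2, 0, 0] : Fin 4 → ℂ) k := by
  fin_cases k <;> rfl

theorem e_imJ (k : Fin 4) :
    (e k).imJ = (![0, 0, Complex.I / 2, Complex.I / 2] : Fin 4 → ℂ) k := by
  fin_cases k <;> rfl

theorem e_imK (k : Fin 4) : (e k).imK = (![0, 0, -1 / 2, 1 / 2] : Fin 4 → ℂ) k := by
  fin_cases k <;> rfl

/-- The coordinates of a complex quaternion in the basis `e`: the inverse map is
`c ↦ ∑ k, c k • e k`. -/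
noncomputable def coordEquiv : ℍ[ℂ] ≃ₗ[ℂ] (Fin 4 → ℂ) where
  toFun a := ![a.re - Complex.I * a.imI, a.re + Complex.I * a.imI,
    -Complex.I * a.imJ - a.imK, -Complex.I * a.imJ + a.imK]
  invFun c := ∑ k, c k • e k
  map_add' a b := by
    ext k; fin_cases k <;> simp <;> ring
  map_smul' c a := by
    ext k; fin_cases k <;> simp <;> ring
  left_inv a := by
    have h := Complex.I_mul_I
    ext <;> simp [Fin.sum_univ_four, e_re, e_imI, e_imJ, e_imK]
    · ring
    · linear_combination -a.imI * h
    · linear_combination -a.imJ * h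
    · ring
  right_inv c := by
    have h := Complex.I_mul_I
    ext k; fin_cases k <;> simp [Fin.sum_univ_four, e_re, e_imI, e_imJ, e_imK]
    · linear_combination (c 1 - c 0) / 2 * h
    · linear_combination (c 0 - c 1) / 2 * h
    · linear_combination -(c 2 + c 3) / 2 * h
    · linear_combination -(c 2 + c 3) / 2 * h

/-- The family `e` as a basis of `ℍ[ℂ]` over `ℂ`. -/
noncomputable def eBasis : Module.Basis (Fin 4) ℂ ℍ[ℂ] := Module.Basis.ofEquivFun coordEquiv

theorem eBasis_apply (k : Fin 4) : eBasis k = e k := by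
  have h : coordEquiv.symm (Pi.single k 1) = ∑ j, (Pi.single k 1 : Fin 4 → ℂ) j • e j := rfl
  rw [eBasis, Module.Basis.coe_ofEquivFun]
  refine h.trans ?_
  rw [Finset.sum_eq_single k]
  · rw [Pi.single_eq_same, one_smul]
  · intro j _ hj
    rw [Pi.single_eq_of_ne hj]
    exact zero_smul ℂ (e j)
  · simp

/-- The norm of `ℍ[ℂ]`: the square root of `∑ k, |a_k|²`, where `a = ∑ k, a_k e_k`. -/
noncomputable instance : NormedAddCommGroup ℍ[ℂ] :=
  NormedAddCommGroup.induced ℍ[ℂ] (EuclideanSpace ℂ (Fin 4))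
    (coordEquiv.trans (WithLp.linearEquiv 2 ℂ (Fin 4 → ℂ)).symm)
    (coordEquiv.trans (WithLp.linearEquiv 2 ℂ (Fin 4 → ℂ)).symm).injective

theorem norm_def (a : ℍ[ℂ]) : ‖a‖ = √(∑ k, ‖eBasis.repr a k‖ ^ 2) :=
  EuclideanSpace.norm_eq (WithLp.toLp 2 (coordEquiv a))

/-- The `ℂ`-linear functional with `f₁ e₁ = f₁ e₃ = 1` and `f₁ e₂ = f₁ e₄ = 0`. -/
noncomputable def f₁ : ℍ[ℂ] →ₗ[ℂ] ℂ := eBasis.constr ℂ ![1, 0, 1, 0]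

/-- The `ℂ`-linear functional with `f₂ e₂ = f₂ e₄ = 1` and `f₂ e₁ = f₂ e₃ = 0`. -/
noncomputable def f₂ : ℍ[ℂ] →ₗ[ℂ] ℂ := eBasis.constr ℂ ![0, 1, 0, 1]

/-- The vectors `i₁ = 1`, `i₂ = a₁ e₁ + a₂ e₂`, `i₃ = b₁ e₁ + b₂ e₂`. -/
noncomputable def iVec (a₁ a₂ b₁ b₂ : ℂ) : Fin 3 → ℍ[ℂ] :=
  ![1, a₁ • e 0 + a₂ • e 1, b₁ • e 0 + b₂ • e 1]

/-- The real linear span `E₃` of `i₁, i₂, i₃`. -/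
noncomputable def E₃ (a₁ a₂ b₁ b₂ : ℂ) : Submodule ℝ ℍ[ℂ] :=
  Submodule.span ℝ (range (iVec a₁ a₂ b₁ b₂))

/-- The set `Ω_ζ = {x i₁ + y i₂ + z i₃ : (x, y, z) ∈ Ω}`. -/
noncomputable def domζ (a₁ a₂ b₁ b₂ : ℂ) (Ω : Set (Fin 3 → ℝ)) : Set ℍ[ℂ] :=
  (fun p : Fin 3 → ℝ => ∑ j, p j • iVec a₁ a₂ b₁ b₂ j) '' Ω

/-- The set `Π_ζ = {ζ ∈ E₃ : f₁ ζ ∈ D₁, f₂ ζ ∈ D₂}`, where `D₁ = f₁(Ω_ζ)` and `D₂ = f₂(Ω_ζ)`. -/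
noncomputable def prodζ (a₁ a₂ b₁ b₂ : ℂ) (Ω : Set (Fin 3 → ℝ)) : Set ℍ[ℂ] :=
  {ζ | ζ ∈ E₃ a₁ a₂ b₁ b₂ ∧ f₁ ζ ∈ f₁ '' domζ a₁ a₂ b₁ b₂ Ω ∧ f₂ ζ ∈ f₂ '' domζ a₁ a₂ b₁ b₂ Ω}

/-- The line `x + y Re a + z Re b = 0`, `y Im a + z Im b = 0` through the origin of `ℝ³`;
`L₁` is `line a₁ b₁` and `L₂` is `line a₂ b₂`. -/
def line (a b : ℂ) : Set (Fin 3 → ℝ) :=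
  {p | p 0 + p 1 * a.re + p 2 * b.re = 0 ∧ p 1 * a.im + p 2 * b.im = 0}

/-- `Ω` is convex in the direction of a line `L` through the origin: it contains every segment
that is parallel to `L` and joins two points of `Ω`. -/
def ConvexInDirection (L Ω : Set (Fin 3 → ℝ)) : Prop :=
  ∀ p ∈ Ω, ∀ q ∈ Ω, q - p ∈ L → segment ℝ p q ⊆ Ω

/-- `Φ` is right-`G`-monogenic on the (relatively open) subset `U` of the real subspace `E`:
continuous on `U`, and at every `ζ ∈ U` there is `Φ'(ζ)` such that
`(Φ(ζ + εh) - Φ(ζ)) ε⁻¹ → h Φ'(ζ)` as `ε → 0+`, for every `h ∈ E`. -/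
def RightGMonogenicOn (E : Submodule ℝ ℍ[ℂ]) (U : Set ℍ[ℂ]) (Φ : ℍ[ℂ] → ℍ[ℂ]) : Prop :=
  ContinuousOn Φ U ∧ ∀ ζ ∈ U, ∃ Φ' : ℍ[ℂ], ∀ h ∈ E,
    Tendsto (fun ε : ℝ => ε⁻¹ • (Φ (ζ + ε • h) - Φ ζ)) (𝓝[>] 0) (𝓝 (h * Φ'))

/-- `Φ` is left-`G`-monogenic on the (relatively open) subset `U` of the real subspace `E`:
continuous on `U`, and at every `ζ ∈ U` there is `Φ'(ζ)` such that
`(Φ(ζ + εh) - Φ(ζ)) ε⁻¹ → Φ'(ζ) h` as `ε → 0+`, for every `h ∈ E`. -/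
def LeftGMonogenicOn (E : Submodule ℝ ℍ[ℂ]) (U : Set ℍ[ℂ]) (Φ : ℍ[ℂ] → ℍ[ℂ]) : Prop :=
  ContinuousOn Φ U ∧ ∀ ζ ∈ U, ∃ Φ' : ℍ[ℂ], ∀ h ∈ E,
    Tendsto (fun ε : ℝ => ε⁻¹ • (Φ (ζ + ε • h) - Φ ζ)) (𝓝[>] 0) (𝓝 (Φ' * h))

end ComplexQuaternion

open ComplexQuaternion

namespace ComplexQuaternion

/-! In the basis `e` the algebra is that of 2×2 complex matrices, and `E₃` consists of diagonal
matrices with entries `f₁ h`, `f₂ h`. Multiplication by `h ∈ E₃`, on either side, therefore scales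
each coordinate by `f₁ h` or by `f₂ h`, and monogenicity splits into four scalar conditions: the
derivative of a coordinate of `Φ` along `h` is `f_s h * c`, with `s` fixed for that coordinate. It
vanishes along `L_s`, the kernel of `f_s` on `E₃`, so by convexity the coordinate is `F (f_s ζ)`
with `F` complex-differentiable in every direction on `D_s` (`exists_factor_through_linearMap`). The
formula `F (f_s ζ)` makes sense on all of `Π_ζ` and gives the extension
(`exists_extension_of_diagonal`). -/

theorem isInducing_coordEquiv : IsInducing (coordEquiv : ℍ[ℂ] → Fin 4 → ℂ) := by
  have h : IsInducing (fun a : ℍ[ℂ] => WithLp.toLp 2 (coordEquiv a)) := ⟨rfl⟩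
  exact (PiLp.homeomorph 2 (fun _ : Fin 4 => ℂ)).isInducing.comp h

theorem tendsto_iff_coordEquiv {α : Type*} {l : Filter α} {φ : α → ℍ[ℂ]} {a : ℍ[ℂ]} :
    Tendsto φ l (𝓝 a) ↔
      ∀ k, Tendsto (fun x => coordEquiv (φ x) k) l (𝓝 (coordEquiv a k)) := by
  rw [isInducing_coordEquiv.tendsto_nhds_iff, tendsto_pi_nhds]
  rfl

theorem continuousOn_iff_coordEquiv {α : Type*} [TopologicalSpace α] {φ : α → ℍ[ℂ]} {s : Set α} :
    ContinuousOn φ s ↔ ∀ k, ContinuousOn (fun x => coordEquiv (φ x) k) s := by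
  simp only [ContinuousOn, ContinuousWithinAt, tendsto_iff_coordEquiv]
  exact ⟨fun h k x hx => h x hx k, fun h x hx k => h k x hx⟩

theorem continuous_coordEquiv_apply (k : Fin 4) : Continuous fun a => coordEquiv a k :=
  (continuous_apply k).comp isInducing_coordEquiv.continuous

theorem coordEquiv_real_smul (r : ℝ) (a : ℍ[ℂ]) (k : Fin 4) :
    coordEquiv (r • a) k = r • coordEquiv a k := by
  have h : r • a = (r : ℂ) • a := by
    rw [← algebraMap_smul ℂ r a]
    rfl
  rw [h, map_smul]
  simp

/-- This is the product of 2×2 matrices, with `a` read as the matrix with rows `(a₀, a₂)` and `(a₃,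
a₁)`. -/
theorem coordEquiv_mul (a b : ℍ[ℂ]) :
    coordEquiv (a * b) =
      ![coordEquiv a 0 * coordEquiv b 0 + coordEquiv a 2 * coordEquiv b 3,
        coordEquiv a 1 * coordEquiv b 1 + coordEquiv a 3 * coordEquiv b 2,
        coordEquiv a 0 * coordEquiv b 2 + coordEquiv a 2 * coordEquiv b 1,
        coordEquiv a 1 * coordEquiv b 3 + coordEquiv a 3 * coordEquiv b 0] := by
  have h := Complex.I_mul_I
  ext k
  fin_cases k <;> simp [coordEquiv] <;> ring_nf <;> simp only [Complex.I_sq] <;> ring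

theorem f₁_apply (a : ℍ[ℂ]) : f₁ a = coordEquiv a 0 + coordEquiv a 2 := by
  simp [f₁, eBasis, Module.Basis.constr_apply_fintype, Fin.sum_univ_four]

theorem f₂_apply (a : ℍ[ℂ]) : f₂ a = coordEquiv a 1 + coordEquiv a 3 := by
  simp [f₂, eBasis, Module.Basis.constr_apply_fintype, Fin.sum_univ_four]

theorem coordEquiv_e (k : Fin 4) : coordEquiv (e k) = Pi.single k 1 := by
  rw [← eBasis_apply, eBasis, Module.Basis.coe_ofEquivFun, LinearEquiv.apply_symm_apply]

theorem coordEquiv_one : coordEquiv (1 : ℍ[ℂ]) = ![1, 1, 0, 0] := by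
  ext k; fin_cases k <;> simp [coordEquiv]

/-- The coordinates of a point of `E₃` in the basis `e`. -/
theorem coordEquiv_sum_iVec (a₁ a₂ b₁ b₂ : ℂ) (p : Fin 3 → ℝ) :
    coordEquiv (∑ j, p j • iVec a₁ a₂ b₁ b₂ j) =
      ![p 0 + p 1 * a₁ + p 2 * b₁, p 0 + p 1 * a₂ + p 2 * b₂, 0, 0] := by
  ext k
  rw [Fin.sum_univ_three, map_add, map_add, Pi.add_apply, Pi.add_apply, coordEquiv_real_smul,
    coordEquiv_real_smul, coordEquiv_real_smul]
  fin_cases k <;> simp [iVec, coordEquiv_one, coordEquiv_e]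

/-! ### Factoring a scalar function through a linear map -/

/-- If `u` has one-sided directional derivatives of the form `T h * c` on an open set that is convex
in the direction of the kernel of the real linear map `T`, then `u` factors through `T`, and so do
its continuity and its directional derivatives. -/
theorem exists_factor_through_linearMap {V : Type*} [NormedAddCommGroup V] [NormedSpace ℝ V]
    [FiniteDimensional ℝ V] (T : V →ₗ[ℝ] ℂ) (hT : Function.Surjective T) {Ω : Set V}
    (hΩ : IsOpen Ω) (hconv : ∀ p ∈ Ω, ∀ q ∈ Ω, T q = T p → segment ℝ p q ⊆ Ω) {u : V → ℂ}
    (hu : ContinuousOn u Ω)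
    (hd : ∀ p ∈ Ω, ∃ c : ℂ, ∀ h : V,
      Tendsto (fun ε : ℝ => ε⁻¹ • (u (p + ε • h) - u p)) (𝓝[>] 0) (𝓝 (T h * c))) :
    ∃ F : ℂ → ℂ, (∀ p ∈ Ω, F (T p) = u p) ∧ ContinuousOn F (T '' Ω) ∧
      ∀ w ∈ T '' Ω, ∃ c : ℂ, ∀ v : ℂ,
        Tendsto (fun ε : ℝ => ε⁻¹ • (F (w + ε • v) - F w)) (𝓝[>] 0) (𝓝 (v * c)) := by
  -- On a segment inside a fibre of `T` the right derivative is `T (q - p) * c = 0`; a continuous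
  -- function with zero right derivative is constant.
  have hconst : ∀ p ∈ Ω, ∀ q ∈ Ω, T q = T p → u q = u p := by
    intro p hp q hq hpq
    have hmem : ∀ t ∈ Icc (0 : ℝ) 1, p + t • (q - p) ∈ Ω := fun t ht =>
      hconv p hp q hq hpq (by rw [segment_eq_image']; exact ⟨t, ht, rfl⟩)
    have hcont : ContinuousOn (fun t : ℝ => u (p + t • (q - p))) (Icc 0 1) :=
      hu.comp (by fun_prop) hmem
    have hder : ∀ t ∈ Ico (0 : ℝ) 1,
        HasDerivWithinAt (fun t : ℝ => u (p + t • (q - p))) 0 (Ici t) t := by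
      intro t ht
      obtain ⟨c, hc⟩ := hd _ (hmem t ⟨ht.1, ht.2.le⟩)
      have h0 := hc (q - p)
      rw [map_sub, hpq, sub_self, zero_mul] at h0
      rw [← hasDerivWithinAt_Ioi_iff_Ici, hasDerivWithinAt_iff_tendsto_slope' (by simp)]
      have hshift : Tendsto (fun s : ℝ => s - t) (𝓝[>] t) (𝓝[>] 0) := by
        refine tendsto_nhdsWithin_iff.2 ⟨?_, ?_⟩
        · have : Tendsto (fun s : ℝ => s - t) (𝓝 t) (𝓝 (t - t)) :=
            (continuous_id.sub continuous_const).tendsto t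
          rw [sub_self] at this
          exact this.mono_left nhdsWithin_le_nhds
        · filter_upwards [self_mem_nhdsWithin] with s hs
          exact sub_pos.2 (mem_Ioi.1 hs)
      refine (h0.comp hshift).congr fun s => ?_
      simp only [Function.comp_apply, slope_def_module]
      rw [add_assoc, ← add_smul, add_sub_cancel]
    simpa using constant_of_has_deriv_right_zero hcont hder 1 ⟨zero_le_one, le_rfl⟩
  classical
  -- The value `0` off `T '' Ω` is never used: `T '' Ω` is open, and the limits involve only points
  -- near `w`.
  let F : ℂ → ℂ := fun w => if h : ∃ p ∈ Ω, T p = w then u h.choose else 0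
  have hF : ∀ p ∈ Ω, F (T p) = u p := by
    intro p hp
    have h : ∃ q ∈ Ω, T q = T p := ⟨p, hp, rfl⟩
    simp only [F, dif_pos h]
    exact hconst p hp _ h.choose_spec.1 h.choose_spec.2
  have hTc : Continuous T := T.continuous_of_finiteDimensional
  have hTo : IsOpenMap T := T.isOpenMap_of_finiteDimensional hT
  refine ⟨F, hF, ?_, ?_⟩
  · rintro _ ⟨p, hp, rfl⟩
    -- Since `T` is open and continuous, limits at `T p` can be tested after composing with `T`.
    refine ContinuousAt.continuousWithinAt ?_
    rw [ContinuousAt, ← hTo.map_nhds_eq hTc.continuousAt, tendsto_map'_iff, hF p hp]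
    exact (hu.continuousAt (hΩ.mem_nhds hp)).congr' <| by
      filter_upwards [hΩ.mem_nhds hp] with q hq using (hF q hq).symm
  · rintro _ ⟨p, hp, rfl⟩
    obtain ⟨c, hc⟩ := hd p hp
    refine ⟨c, fun v => ?_⟩
    obtain ⟨h, rfl⟩ := hT v
    have hnear : ∀ᶠ ε : ℝ in 𝓝[>] 0, p + ε • h ∈ Ω := by
      have hcont : Continuous fun ε : ℝ => p + ε • h := by fun_prop
      exact nhdsWithin_le_nhds (hcont.continuousAt.preimage_mem_nhds
        (hΩ.mem_nhds (by simpa using hp)))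
    refine (hc h).congr' ?_
    filter_upwards [hnear] with ε hε
    rw [← hF _ hε, ← hF p hp, map_add, map_smul]

/-! ### Assembling the extension from its coordinates -/

/-- Extension of maps whose directional derivative `m h d` in the direction `h` acts diagonally in
the basis `e`: its `k`-th coordinate is `f_{s k}(h)` times the `k`-th coordinate of `d`. -/
theorem exists_extension_of_diagonal {a₁ a₂ b₁ b₂ : ℂ}
    (hf₁ : f₁ '' (E₃ a₁ a₂ b₁ b₂ : Set ℍ[ℂ]) = univ)
    (hf₂ : f₂ '' (E₃ a₁ a₂ b₁ b₂ : Set ℍ[ℂ]) = univ)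
    {Ω : Set (Fin 3 → ℝ)} (hΩ : IsOpen Ω)
    (hL₁ : ConvexInDirection (line a₁ b₁) Ω) (hL₂ : ConvexInDirection (line a₂ b₂) Ω)
    (m : ℍ[ℂ] → ℍ[ℂ] → ℍ[ℂ]) (s : Fin 4 → Bool)
    (hm : ∀ h ∈ E₃ a₁ a₂ b₁ b₂, ∀ d k,
      coordEquiv (m h d) k = (bif s k then f₁ h else f₂ h) * coordEquiv d k)
    {Φ : ℍ[ℂ] → ℍ[ℂ]} (hΦ : ContinuousOn Φ (domζ a₁ a₂ b₁ b₂ Ω))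
    (hd : ∀ ζ ∈ domζ a₁ a₂ b₁ b₂ Ω, ∃ d, ∀ h ∈ E₃ a₁ a₂ b₁ b₂,
      Tendsto (fun ε : ℝ => ε⁻¹ • (Φ (ζ + ε • h) - Φ ζ)) (𝓝[>] 0) (𝓝 (m h d))) :
    ∃ Ψ : ℍ[ℂ] → ℍ[ℂ], (ContinuousOn Ψ (prodζ a₁ a₂ b₁ b₂ Ω) ∧
      ∀ ζ ∈ prodζ a₁ a₂ b₁ b₂ Ω, ∃ d, ∀ h ∈ E₃ a₁ a₂ b₁ b₂,
        Tendsto (fun ε : ℝ => ε⁻¹ • (Ψ (ζ + ε • h) - Ψ ζ)) (𝓝[>] 0) (𝓝 (m h d))) ∧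
      EqOn Ψ Φ (domζ a₁ a₂ b₁ b₂ Ω) := by
  let ι : (Fin 3 → ℝ) →ₗ[ℝ] ℍ[ℂ] := Fintype.linearCombination ℝ (iVec a₁ a₂ b₁ b₂)
  have hι : ∀ p, ι p = ∑ j, p j • iVec a₁ a₂ b₁ b₂ j := fun p => rfl
  have hE : LinearMap.range ι = E₃ a₁ a₂ b₁ b₂ := Fintype.range_linearCombination ℝ _
  have hιE : ∀ p, ι p ∈ E₃ a₁ a₂ b₁ b₂ := fun p => hE ▸ LinearMap.mem_range_self ι p
  have hEι : ∀ h ∈ E₃ a₁ a₂ b₁ b₂, ∃ p, ι p = h := fun h hh => LinearMap.mem_range.1 (hE ▸ hh)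
  have hιc : Continuous ι := by
    rw [← continuousOn_univ, continuousOn_iff_coordEquiv]
    intro k
    simp only [hι, coordEquiv_sum_iVec]
    fin_cases k <;> simp <;> fun_prop
  have hΩι : ∀ p ∈ Ω, ι p ∈ domζ a₁ a₂ b₁ b₂ Ω := fun p hp => ⟨p, hp, rfl⟩
  let g : Fin 4 → ℍ[ℂ] → ℂ := fun k ζ => bif s k then f₁ ζ else f₂ ζ
  have hgc : ∀ k, Continuous (g k) := by
    intro k
    have h := continuous_coordEquiv_apply
    cases hs : s k <;> simp only [g, hs, cond_true, cond_false, f₁_apply, f₂_apply]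
    · exact (h 1).add (h 3)
    · exact (h 0).add (h 2)
  have hgadd : ∀ k x y, g k (x + y) = g k x + g k y := by
    intro k x y
    cases hs : s k <;> simp [g, hs]
  have hgsmul : ∀ k (r : ℝ) x, g k (r • x) = r • g k x := by
    intro k r x
    cases hs : s k <;>
      simp only [g, hs, cond_true, cond_false, f₁_apply, f₂_apply, coordEquiv_real_smul, smul_add]
  let T : Fin 4 → (Fin 3 → ℝ) →ₗ[ℝ] ℂ := fun k =>
    { toFun := fun p => g k (ι p)
      map_add' := fun p q => by rw [map_add, hgadd]
      map_smul' := fun r p => by rw [map_smul, hgsmul]; rfl }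
  have hTg : ∀ k p, T k p = g k (ι p) := fun _ _ => rfl
  have hTsurj : ∀ k, Function.Surjective (T k) := by
    intro k w
    have h : ∃ x ∈ E₃ a₁ a₂ b₁ b₂, g k x = w := by
      cases hs : s k <;> simp only [g, hs, cond_true, cond_false]
      · exact eq_univ_iff_forall.1 hf₂ w
      · exact eq_univ_iff_forall.1 hf₁ w
    obtain ⟨x, hx, rfl⟩ := h
    obtain ⟨p, rfl⟩ := hEι x hx
    exact ⟨p, rfl⟩
  -- The two equations of the line are the real and imaginary parts of one complex equation, so the
  -- line contains the kernel of the functional.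
  have hline : ∀ (a b : ℂ) (p : Fin 3 → ℝ),
      (p 0 : ℂ) + p 1 * a + p 2 * b = 0 → p ∈ line a b := by
    intro a b p h
    exact ⟨by simpa using congrArg Complex.re h, by simpa using congrArg Complex.im h⟩
  have hconv : ∀ k, ∀ p ∈ Ω, ∀ q ∈ Ω, T k q = T k p → segment ℝ p q ⊆ Ω := by
    intro k p hp q hq hpq
    have h : T k (q - p) = 0 := by rw [map_sub, hpq, sub_self]
    rw [hTg] at h
    cases hs : s k <;>
      simp only [g, hs, cond_true, cond_false, f₁_apply, f₂_apply, hι, coordEquiv_sum_iVec] at h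
    · exact hL₂ p hp q hq (hline _ _ _ (by simpa using h))
    · exact hL₁ p hp q hq (hline _ _ _ (by simpa using h))
  have hfac := fun k => exists_factor_through_linearMap (T k) (hTsurj k) hΩ (hconv k)
    (u := fun p => coordEquiv (Φ (ι p)) k)
    (continuousOn_iff_coordEquiv.1 (hΦ.comp hιc.continuousOn hΩι) k) (by
      intro p hp
      obtain ⟨d, hd⟩ := hd _ (hΩι p hp)
      refine ⟨coordEquiv d k, fun h => ?_⟩
      have := tendsto_iff_coordEquiv.1 (hd (ι h) (hιE h)) k
      rw [hm _ (hιE h)] at this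
      change Tendsto _ _ (𝓝 (g k (ι h) * coordEquiv d k))
      simpa only [coordEquiv_real_smul, map_sub, Pi.sub_apply, map_add, map_smul] using this)
  choose F hF hFc hFd using hfac
  let Ψ : ℍ[ℂ] → ℍ[ℂ] := fun ζ => coordEquiv.symm fun k => F k (g k ζ)
  have hΨ : ∀ ζ k, coordEquiv (Ψ ζ) k = F k (g k ζ) := fun ζ k => by
    simp only [Ψ, LinearEquiv.apply_symm_apply]
  have hprod : ∀ ζ ∈ prodζ a₁ a₂ b₁ b₂ Ω, ∀ k, g k ζ ∈ T k '' Ω := by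
    rintro ζ ⟨-, ⟨_, ⟨p, hp, rfl⟩, h₁⟩, ⟨_, ⟨q, hq, rfl⟩, h₂⟩⟩ k
    cases hs : s k
    · exact ⟨q, hq, by simpa only [hTg, g, hs, cond_false, hι] using h₂⟩
    · exact ⟨p, hp, by simpa only [hTg, g, hs, cond_true, hι] using h₁⟩
  refine ⟨Ψ, ⟨?_, ?_⟩, ?_⟩
  · rw [continuousOn_iff_coordEquiv]
    intro k
    simp only [hΨ]
    exact (hFc k).comp (hgc k).continuousOn fun ζ hζ => hprod ζ hζ k
  · intro ζ hζ
    choose c hc using fun k => hFd k _ (hprod ζ hζ k)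
    refine ⟨coordEquiv.symm c, fun h hh => tendsto_iff_coordEquiv.2 fun k => ?_⟩
    rw [hm h hh, LinearEquiv.apply_symm_apply]
    simpa only [coordEquiv_real_smul, map_sub, Pi.sub_apply, hΨ, hgadd, hgsmul] using hc k (g k h)
  · rintro _ ⟨p, hp, rfl⟩
    refine coordEquiv.injective (funext fun k => ?_)
    rw [hΨ]
    exact hF k p hp

theorem coordEquiv_of_mem_E₃ {a₁ a₂ b₁ b₂ : ℂ} {h : ℍ[ℂ]} (hh : h ∈ E₃ a₁ a₂ b₁ b₂) :
    coordEquiv h = ![f₁ h, f₂ h, 0, 0] := by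
  rw [E₃, ← Fintype.range_linearCombination] at hh
  obtain ⟨p, rfl⟩ := hh
  rw [f₁_apply, f₂_apply, Fintype.linearCombination_apply, coordEquiv_sum_iVec]
  simp

end ComplexQuaternion

theorem mainTheorem5 (a₁ a₂ b₁ b₂ : ℂ)
    (hli : LinearIndependent ℝ (iVec a₁ a₂ b₁ b₂))
    (hf₁ : f₁ '' (E₃ a₁ a₂ b₁ b₂ : Set ℍ[ℂ]) = univ)
    (hf₂ : f₂ '' (E₃ a₁ a₂ b₁ b₂ : Set ℍ[ℂ]) = univ)
    (Ω : Set (Fin 3 → ℝ)) (hΩ : IsOpen Ω) (hΩc : IsConnected Ω)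
    (hL₁ : ConvexInDirection (line a₁ b₁) Ω) (hL₂ : ConvexInDirection (line a₂ b₂) Ω) :
    (∀ Φ : ℍ[ℂ] → ℍ[ℂ],
      RightGMonogenicOn (E₃ a₁ a₂ b₁ b₂) (domζ a₁ a₂ b₁ b₂ Ω) Φ →
        ∃ Ψ : ℍ[ℂ] → ℍ[ℂ],
          RightGMonogenicOn (E₃ a₁ a₂ b₁ b₂) (prodζ a₁ a₂ b₁ b₂ Ω) Ψ ∧
            EqOn Ψ Φ (domζ a₁ a₂ b₁ b₂ Ω)) ∧
    (∀ Φ : ℍ[ℂ] → ℍ[ℂ],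
      LeftGMonogenicOn (E₃ a₁ a₂ b₁ b₂) (domζ a₁ a₂ b₁ b₂ Ω) Φ →
        ∃ Ψ : ℍ[ℂ] → ℍ[ℂ],
          LeftGMonogenicOn (E₃ a₁ a₂ b₁ b₂) (prodζ a₁ a₂ b₁ b₂ Ω) Ψ ∧
            EqOn Ψ Φ (domζ a₁ a₂ b₁ b₂ Ω)) := by
  constructor
  · rintro Φ ⟨hΦ, hd⟩
    refine exists_extension_of_diagonal hf₁ hf₂ hΩ hL₁ hL₂ (fun h d => h * d)
      -- Left multiplication by a diagonal matrix scales rows: entries 0, 2 by `f₁ h` and 1, 3 by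
      -- `f₂ h`.
      ![true, false, true, false] (fun h hh d k => ?_) hΦ hd
    rw [coordEquiv_mul, coordEquiv_of_mem_E₃ hh]
    fin_cases k <;> simp
  · rintro Φ ⟨hΦ, hd⟩
    refine exists_extension_of_diagonal hf₁ hf₂ hΩ hL₁ hL₂ (fun h d => d * h)
      -- Right multiplication scales columns, so the off-diagonal entries 2 and 3 swap factors.
      ![true, false, false, true] (fun h hh d k => ?_) hΦ hd
    rw [coordEquiv_mul, coordEquiv_of_mem_E₃ hh]
    fin_cases k <;> simp [mul_comm]
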